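/- Let $\Sigma$ be a countably infinite set of colors, and let $\mathrm{inj}(\Sigma)$ be the set of injective sequences $\omega\to\Sigma$, which serve both as codewords and as guesswords (infinite Mastermind without duplication of colors). For a guessword $s$ and a codeword $w$ put $\|s=w\|=|\{n : s(n)=w(n)\}|$ and $\|s\neq w\|=|\{n : s(n)\neq w(n)\}|$. The Mastermind feedback is the triple $(\kappa,\rho,\varepsilon)$, where $\kappa=\|s=w\|$, where $\rho$ is the maximal number of incorrect pegs of $s$ that can become correct in a permutation of the incorrect pegs of $s$ (the correct pegs remaining in place), and where $\varepsilon$ is the minimal number of pegs that remain incorrect after such a permutation; these are cardinals, finite or $\omega$. A set $S\subseteq\mathrm{inj}(\Sigma)$ is winning for a given kind of feedback if any two codewords $w,w'\in\mathrm{inj}(\Sigma)$ that receive the same feedback on every $s\in S$ are equal. Let $\mathfrak{mm}$, $\mathfrak{mm}_s$ and $\mathfrak{mm}_=$ be the smallest sizes of winning sets for the feedback $(\kappa,\rho,\varepsilon)$, for the feedback $(\|s=w\|,\|s\neq w\|)$, and for the feedback $\|s=w\|$, respectively. Let $\mathfrak d(\neq^*,\mathrm{inj}(\omega))$ be the smallest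 size of a family $D$ of injective functions $\omega\to\omega$ such that for every injective $w:\omega\to\omega$ there is $s\in D$ with $\|s=w\|<\omega$. Let $\mathrm{cov}(\mathcal M)$ be the smallest size of a family of meager subsets of Baire space ${}^\omega\omega$ whose union is ${}^\omega\omega$. Let $\mathfrak m(\mathbb C)$ be the smallest size of a family of dense subsets of Cohen forcing $\mathbb C$ (the finite sequences of natural numbers, ordered by end-extension) such that no filter on $\mathbb C$ meets every member of the family. Then $$\mathfrak{mm}=\mathfrak{mm}_s=\mathfrak{mm}_= =\mathfrak d(\neq^*,\mathrm{inj}(\omega))=\mathrm{cov}(\mathcal M)=\mathfrak m(\mathbb C).$$ -/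

import Mathlib

open Cardinal

namespace InfiniteMastermind

/-! ### Feedback in infinite Mastermind

Words are sequences `ℕ → C` of colors. All counts are finite or countably infinite, so they are
recorded in `ℕ∞`, with `⊤` standing for `ω`. -/

section Feedback

variable {C : Type}

/-- The correctness count `‖s = w‖`: the number of positions at which `s` and `w` agree. -/
noncomputable def correctCount (s w : ℕ → C) : ℕ∞ :=
  {n | s n = w n}.encard

/-- The incorrectness count `‖s ≠ w‖`: the number of positions at which `s` and `w` differ. -/
noncomputable def incorrectCount (s w : ℕ → C) : ℕ∞ :=
  {n | s n ≠ w n}.encard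

/-- The rearrangement count `ρ` of the guessword `s` for the codeword `w`: the largest number of
pegs that become correct in a permutation `π` of the incorrect pegs of `s` (the correct pegs stay
where they are; after the rearrangement position `n` carries the color `s (π n)`). -/
noncomputable def rearrangementCount (s w : ℕ → C) : ℕ∞ :=
  ⨆ π : Equiv.Perm {n : ℕ // s n ≠ w n}, {n : {n : ℕ // s n ≠ w n} | s (π n) = w n}.encard

/-- The inherent error count `ε` of the guessword `s` for the codeword `w`: the smallest number of
pegs that are still incorrect after a permutation of the incorrect pegs of `s`. -/
noncomputable def inherentErrorCount (s w : ℕ → C) : ℕ∞ :=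
  ⨅ π : Equiv.Perm {n : ℕ // s n ≠ w n}, {n : {n : ℕ // s n ≠ w n} | s (π n) ≠ w n}.encard

/-- The Mastermind feedback `(κ, ρ, ε)` on the guessword `s` for the codeword `w`. -/
noncomputable def mastermindFeedback (s w : ℕ → C) : ℕ∞ × ℕ∞ × ℕ∞ :=
  (correctCount s w, rearrangementCount s w, inherentErrorCount s w)

/-- The feedback of simplified Mastermind: the correctness and the incorrectness count. -/
noncomputable def simplifiedFeedback (s w : ℕ → C) : ℕ∞ × ℕ∞ :=
  (correctCount s w, incorrectCount s w)

end Feedback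

/-! ### Winning sets and mastermind numbers, no duplication of colors

The codewords and the guesswords are the injective sequences of colors, `ℕ ↪ C`. -/

/-- A set `S` of injective guesswords is winning for a kind of feedback if every injective codeword
is uniquely determined by the feedback answers to the guesswords in `S`. -/
def IsWinningSet {C F : Type} (feedback : (ℕ → C) → (ℕ → C) → F) (S : Set (ℕ ↪ C)) : Prop :=
  ∀ w w' : ℕ ↪ C, (∀ s ∈ S, feedback s w = feedback s w') → w = w'

/-- The size of the smallest winning set of injective guesswords for a kind of feedback. -/
noncomputable def leastWinningSize {C F : Type} (feedback : (ℕ → C) → (ℕ → C) → F) : Cardinal.{0} :=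
  sInf {κ | ∃ S : Set (ℕ ↪ C), IsWinningSet feedback S ∧ #S = κ}

/-- The mastermind number for the color set `C` (no duplication). -/
noncomputable def mm (C : Type) : Cardinal.{0} :=
  leastWinningSize (mastermindFeedback (C := C))

/-- The simplified mastermind number for the color set `C` (no duplication). -/
noncomputable def mms (C : Type) : Cardinal.{0} :=
  leastWinningSize (simplifiedFeedback (C := C))

/-- The correctness-only simplified mastermind number for the color set `C` (no duplication). -/
noncomputable def mmEq (C : Type) : Cardinal.{0} :=
  leastWinningSize (correctCount (C := C))

/-! ### Cardinal characteristics -/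

/-- The eventually different number of injective Baire space: the size of the smallest family `S`
of injective functions such that every injective function agrees with some member of `S` at only
finitely many places. -/
noncomputable def eventuallyDifferentInj : Cardinal.{0} :=
  sInf {κ | ∃ S : Set (ℕ ↪ ℕ), (∀ w : ℕ ↪ ℕ, ∃ s ∈ S, {n | s n = w n}.Finite) ∧ #S = κ}

/-- The covering number of the meager ideal: the size of the smallest family of meager subsets of
Baire space `ℕ → ℕ` (with the product topology) that covers the whole space. -/
noncomputable def covMeager : Cardinal.{0} :=
  sInf {κ | ∃ F : Set (Set (ℕ → ℕ)), (∀ A ∈ F, IsMeagre A) ∧ ⋃₀ F = Set.univ ∧ #F = κ}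

/-- A subset `D` of a forcing notion is dense if every condition has an extension in `D`. -/
def IsDenseSet {P : Type} [Preorder P] (D : Set P) : Prop :=
  ∀ p : P, ∃ q ∈ D, q ≤ p

/-- The Martin number of a forcing notion: the size of the smallest family of dense sets for which
no filter meets every member of the family. -/
noncomputable def martinNumber (P : Type) [Preorder P] : Cardinal.{0} :=
  sInf {κ | ∃ 𝒟 : Set (Set P), (∀ D ∈ 𝒟, IsDenseSet D) ∧
    (¬ ∃ G : Order.PFilter P, ∀ D ∈ 𝒟, ∃ p ∈ D, p ∈ G) ∧ #𝒟 = κ}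

/-- Cohen forcing, as the forcing that adds a function `ℕ → ℕ` by initial segments: a condition is
a finite sequence of natural numbers. -/
structure CohenForcing : Type where
  /-- The finite sequence. -/
  seq : List ℕ

/-- A stronger (smaller) condition is a longer sequence that extends the given one. -/
instance : PartialOrder CohenForcing where
  le p q := q.seq <+: p.seq
  le_refl p := List.prefix_refl p.seq
  le_trans _ _ _ hpq hqr := hqr.trans hpq
  le_antisymm p q hpq hqp := by
    cases p
    cases q
    exact congrArg CohenForcing.mk (hqp.eq_of_length_le hpq.length_le)

end InfiniteMastermind

namespace InfiniteMastermind

/-! ### A generic injection -/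

theorem isOpen_of_forall_cylinder {U : Set (ℕ → ℕ)}
    (h : ∀ x ∈ U, ∃ n, ∀ y : ℕ → ℕ, (∀ i < n, y i = x i) → y ∈ U) : IsOpen U := by
  rw [isOpen_iff_mem_nhds]
  intro x hx
  obtain ⟨n, hn⟩ := h x hx
  exact Filter.mem_of_superset
    ((PiNat.isOpen_cylinder (fun _ => ℕ) x n).mem_nhds (PiNat.self_mem_cylinder x n)) hn

theorem exists_cylinder_subset {U : Set (ℕ → ℕ)} (hU : IsOpen U) {x : ℕ → ℕ} (hx : x ∈ U) :
    ∃ n, ∀ y : ℕ → ℕ, (∀ i < n, y i = x i) → y ∈ U := by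
  obtain ⟨_, ⟨z, n, rfl⟩, hz, hsub⟩ :=
    (PiNat.isTopologicalBasis_cylinders (fun _ : ℕ => ℕ)).exists_subset_of_mem_open hx hU
  exact ⟨n, fun y hy => hsub fun i hi => (hy i hi).trans (hz i hi)⟩

theorem dense_of_forall_cylinder {U : Set (ℕ → ℕ)}
    (h : ∀ (x : ℕ → ℕ) (n : ℕ), ∃ y ∈ U, ∀ i < n, y i = x i) : Dense U := by
  rw [dense_iff_inter_open]
  rintro V hV ⟨x, hx⟩
  obtain ⟨n, hn⟩ := exists_cylinder_subset hV hx
  obtain ⟨y, hy, hyx⟩ := h x n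
  exact ⟨y, hn y hyx, hy⟩

/-- A strict upper bound of the first `n + 1` values of `x`, strictly increasing in `n`. -/
def strictBound (x : ℕ → ℕ) (n : ℕ) : ℕ := ∑ i ∈ Finset.range (n + 1), (x i + 1)

theorem strictBound_strictMono (x : ℕ → ℕ) : StrictMono (strictBound x) := by
  refine strictMono_nat_of_lt_succ fun n => ?_
  rw [strictBound, strictBound, Finset.sum_range_succ _ (n + 1)]
  omega

theorem lt_strictBound (x : ℕ → ℕ) {i n : ℕ} (h : i ≤ n) : x i < strictBound x n :=
  Nat.lt_of_succ_le <| Finset.single_le_sum (f := fun i => x i + 1) (fun _ _ => Nat.zero_le _)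
    (Finset.mem_range.2 (Nat.lt_succ_of_le h))

theorem strictBound_congr {x y : ℕ → ℕ} {n : ℕ} (h : ∀ i ≤ n, x i = y i) :
    strictBound x n = strictBound y n :=
  Finset.sum_congr rfl fun i hi => by rw [h i (Nat.lt_succ_iff.1 (Finset.mem_range.1 hi))]

open Classical in
/-- The sequence `x`, with the values that would destroy injectivity replaced by fresh ones. -/
noncomputable def makeInjective (x : ℕ → ℕ) (n : ℕ) : ℕ :=
  if ∀ i < n, x n ≠ x i ∧ x n ≠ strictBound x i then x n else strictBound x n

/-- A fresh value exceeds all earlier entries and all earlier fresh values; a retained entry was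
tested against both. -/
theorem makeInjective_injective (x : ℕ → ℕ) : Function.Injective (makeInjective x) := by
  refine Function.Injective.of_lt_imp_ne fun m n hmn => ?_
  have h1 := strictBound_strictMono x hmn
  have h2 := lt_strictBound x hmn.le
  unfold makeInjective
  split_ifs with hm hn hn
  · exact (hn m hmn).1.symm
  · exact h2.ne
  · exact (hn m hmn).2.symm
  · exact h1.ne

theorem makeInjective_congr {x y : ℕ → ℕ} {n : ℕ} (h : ∀ i ≤ n, x i = y i) :
    makeInjective x n = makeInjective y n := by
  have hb := strictBound_congr h
  have : (∀ i < n, x n ≠ x i ∧ x n ≠ strictBound x i) ↔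
      ∀ i < n, y n ≠ y i ∧ y n ≠ strictBound y i := by
    refine forall₂_congr fun i hi => ?_
    rw [h n le_rfl, h i hi.le, strictBound_congr fun j hj => h j (hj.trans hi.le)]
  rw [makeInjective, makeInjective]
  simp only [this]
  rw [hb, h n le_rfl]

/-- The density half of genericity. The value `f n` is chosen above every entry and bound of the
prefix; padding with `f n + 1` keeps later entries and bounds away from it, so it is retained at `φ
n`. -/
theorem exists_makeInjective_eq {f φ : ℕ → ℕ} (hf : f.Injective) (hφ : φ.Injective)
    (x : ℕ → ℕ) (N k : ℕ) :
    ∃ y : ℕ → ℕ, (∃ n ≥ N, makeInjective y (φ n) = f n) ∧ ∀ i < k, y i = x i := by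
  obtain ⟨n, ⟨hnf, hnφ⟩, hnN⟩ : ∃ n, (strictBound x k < f n ∧ k < φ n) ∧ N ≤ n := by
    have h1 := hf.nat_tendsto_atTop.eventually_gt_atTop (strictBound x k)
    have h2 := hφ.nat_tendsto_atTop.eventually_gt_atTop k
    exact ((h1.and h2).and (Filter.eventually_ge_atTop N)).exists
  let y : ℕ → ℕ := fun i => if i < k then x i else if i = φ n then f n else f n + 1
  have hyx : ∀ i < k, y i = x i := fun i hi => if_pos hi
  have hyn : y (φ n) = f n := by simp [y, hnφ.not_gt]
  have hyb : ∀ i, k ≤ i → i ≠ φ n → y i = f n + 1 := fun i hi hne => by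
    simp [y, hi.not_gt, hne]
  refine ⟨y, ⟨n, hnN, ?_⟩, hyx⟩
  rw [makeInjective, if_pos, hyn]
  intro i hi
  rw [hyn]
  rcases lt_or_ge i k with hik | hik
  · have h1 := lt_strictBound x hik.le
    have h2 := strictBound_strictMono x hik
    rw [hyx i hik, strictBound_congr fun j hj => hyx j (hj.trans_lt hik)]
    omega
  · have h1 := lt_strictBound y (le_refl i)
    rw [hyb i hik hi.ne] at h1 ⊢
    omega

theorem residual_infinite_makeInjective_eq {f φ : ℕ → ℕ} (hf : f.Injective) (hφ : φ.Injective) :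
    {x | {n | makeInjective x (φ n) = f n}.Infinite} ∈ residual (ℕ → ℕ) := by
  have key : ∀ N, {x | ∃ n ≥ N, makeInjective x (φ n) = f n} ∈ residual (ℕ → ℕ) := fun N => by
    refine residual_of_dense_open (isOpen_of_forall_cylinder ?_)
      (dense_of_forall_cylinder fun x k => exists_makeInjective_eq hf hφ x N k)
    rintro x ⟨n, hnN, hn⟩
    exact ⟨φ n + 1, fun y hy => ⟨n, hnN,
      (makeInjective_congr fun i hi => hy i (Nat.lt_succ_of_le hi)).trans hn⟩⟩
  filter_upwards [countable_iInter_mem.2 key] with x hx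
  rw [← Nat.frequently_atTop_iff_infinite, Filter.frequently_atTop]
  exact Set.mem_iInter.1 hx

/-! ### Comparing cardinal characteristics -/

/-- Nonemptiness is carried along because the infimum of the empty set is 0. -/
theorem sInf_le_sInf_of_forall_exists {A B : Set Cardinal.{0}} (hA : A.Nonempty)
    (h : ∀ a ∈ A, ∃ b ∈ B, b ≤ a) : B.Nonempty ∧ sInf B ≤ sInf A := by
  obtain ⟨b, hb, hba⟩ := h _ (csInf_mem hA)
  exact ⟨⟨b, hb⟩, (csInf_le' hb).trans hba⟩

/-- The sizes of the families of meager sets that cover Baire space. -/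
abbrev meagerCoverSizes : Set Cardinal.{0} :=
  {κ | ∃ F : Set (Set (ℕ → ℕ)), (∀ A ∈ F, IsMeagre A) ∧ ⋃₀ F = Set.univ ∧ #F = κ}

/-- The sizes of the sets of injective functions that contain, for every injective function, an
eventually different one. -/
abbrev eventuallyDifferentSizes : Set Cardinal.{0} :=
  {κ | ∃ S : Set (ℕ ↪ ℕ), (∀ w : ℕ ↪ ℕ, ∃ s ∈ S, {n | s n = w n}.Finite) ∧ #S = κ}

/-- The sizes of the families of dense subsets of `P` that no filter meets. -/
abbrev unmetDenseSizes (P : Type) [Preorder P] : Set Cardinal.{0} :=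
  {κ | ∃ 𝒟 : Set (Set P), (∀ D ∈ 𝒟, IsDenseSet D) ∧
    (¬ ∃ G : Order.PFilter P, ∀ D ∈ 𝒟, ∃ p ∈ D, p ∈ G) ∧ #𝒟 = κ}

/-- The sizes of the winning sets for a kind of feedback. -/
abbrev winningSizes {C F : Type} (feedback : (ℕ → C) → (ℕ → C) → F) : Set Cardinal.{0} :=
  {κ | ∃ S : Set (ℕ ↪ C), IsWinningSet feedback S ∧ #S = κ}

theorem aleph0_lt_mk_of_sUnion_eq_univ {F : Set (Set (ℕ → ℕ))} (hF : ∀ A ∈ F, IsMeagre A)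
    (hcov : ⋃₀ F = Set.univ) : ℵ₀ < #F := by
  by_contra h
  have hc : F.Countable := (Cardinal.le_aleph0_iff_set_countable).1 (not_lt.1 h)
  refine not_isMeagre_of_isOpen (X := ℕ → ℕ) isOpen_univ Set.univ_nonempty ?_
  rw [← hcov, Set.sUnion_eq_biUnion]
  exact isMeagre_biUnion hc hF

theorem aleph0_lt_covMeager : ℵ₀ < covMeager := by
  have hne : meagerCoverSizes.Nonempty := by
    refine ⟨_, Set.range fun x : ℕ → ℕ => {x}, ?_, ?_, rfl⟩
    · rintro _ ⟨x, rfl⟩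
      have hd : Dense ({x}ᶜ : Set (ℕ → ℕ)) := by
        refine dense_of_forall_cylinder fun z n => ?_
        refine ⟨Function.update z n (x n + 1), fun h => ?_, fun i hi => ?_⟩
        · simpa using congrFun h n
        · exact Function.update_of_ne hi.ne _ _
      exact residual_of_dense_open isClosed_singleton.isOpen_compl hd
    · exact Set.eq_univ_of_forall fun x => ⟨{x}, ⟨x, rfl⟩, rfl⟩
  obtain ⟨F, hF, hcov, h⟩ := csInf_mem hne
  exact (aleph0_lt_mk_of_sUnion_eq_univ hF hcov).trans_eq h

theorem exists_meagerCover_of_residual {T : Type} (P : T → (ℕ → ℕ) → Prop)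
    (hP : ∀ t, {x | P t x} ∈ residual (ℕ → ℕ)) (h : ∀ x, ∃ t, ¬ P t x) :
    ∃ κ ∈ meagerCoverSizes, κ ≤ #T := by
  refine ⟨_, ⟨Set.range fun t => {x | P t x}ᶜ, ?_, ?_, rfl⟩, Cardinal.mk_range_le⟩
  · rintro _ ⟨t, rfl⟩
    rw [IsMeagre, compl_compl]
    exact hP t
  · exact Set.eq_univ_of_forall fun x => (h x).elim fun t ht => ⟨_, ⟨t, rfl⟩, ht⟩

theorem exists_meagerCover_of_eventuallyDifferent {κ : Cardinal}
    (hκ : κ ∈ eventuallyDifferentSizes) : ∃ μ ∈ meagerCoverSizes, μ ≤ κ := by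
  obtain ⟨S, hS, rfl⟩ := hκ
  refine exists_meagerCover_of_residual
    (fun (s : S) x => {n | makeInjective x n = s.1 n}.Infinite)
    (fun s => residual_infinite_makeInjective_eq s.1.injective Function.injective_id) fun x => ?_
  obtain ⟨s, hs, hfin⟩ := hS ⟨makeInjective x, makeInjective_injective x⟩
  refine ⟨⟨s, hs⟩, Set.not_infinite.2 ?_⟩
  simpa only [eq_comm, Function.Embedding.coeFn_mk] using hfin

theorem eventuallyDifferentSizes_nonempty : eventuallyDifferentSizes.Nonempty := by
  refine ⟨_, Set.univ, fun w => ⟨⟨fun n => w (n + 1), fun m n h => ?_⟩, trivial, ?_⟩, rfl⟩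
  · simpa using h
  · refine Set.Finite.subset Set.finite_empty fun n hn => ?_
    exact absurd (w.injective hn) n.succ_ne_self

/-! ### Martin's number of Cohen forcing is at most the covering number -/

/-- The basic open set of the functions with initial segment `l`. -/
def extensions (l : List ℕ) : Set (ℕ → ℕ) := {f | ∀ i a, l[i]? = some a → f i = a}

theorem exists_forall_mem_extensions (G : Order.PFilter CohenForcing) :
    ∃ f, ∀ p ∈ G, f ∈ extensions p.seq := by
  have key : ∀ i a b : ℕ, (∃ p ∈ G, p.seq[i]? = some a) →
      (∃ p ∈ G, p.seq[i]? = some b) → a = b := by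
    rintro i a b ⟨p, hp, hpa⟩ ⟨q, hq, hqb⟩
    obtain ⟨r, -, hrp, hrq⟩ := G.directed p hp q hq
    have h1 : r.seq[i]? = some a := by
      obtain ⟨t, ht⟩ : p.seq <+: r.seq := hrp
      rw [← ht]
      exact List.getElem?_append_left (List.getElem?_eq_some_iff.1 hpa).1 ▸ hpa
    have h2 : r.seq[i]? = some b := by
      obtain ⟨t, ht⟩ : q.seq <+: r.seq := hrq
      rw [← ht]
      exact List.getElem?_append_left (List.getElem?_eq_some_iff.1 hqb).1 ▸ hqb
    exact Option.some_injective _ (h1.symm.trans h2)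
  have ex : ∀ i : ℕ, ∃ a, ∀ p ∈ G, ∀ b, p.seq[i]? = some b → a = b := fun i => by
    by_cases h : ∃ a, ∃ p ∈ G, p.seq[i]? = some a
    · obtain ⟨a, ha⟩ := h
      exact ⟨a, fun p hp b hb => key i a b ha ⟨p, hp, hb⟩⟩
    -- A filter may decide only finitely many places; the others get the value 0.
    · exact ⟨0, fun p hp b hb => (h ⟨b, p, hp, hb⟩).elim⟩
  choose f hf using ex
  exact ⟨f, fun p hp i b hb => hf i p hp b hb⟩

theorem isDenseSet_extensions_subset {U : Set (ℕ → ℕ)} (hU : IsOpen U) (hd : Dense U) :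
    IsDenseSet {p : CohenForcing | extensions p.seq ⊆ U} := by
  intro p
  have hopen : IsOpen (extensions p.seq) := by
    refine isOpen_of_forall_cylinder fun x hx => ⟨p.seq.length, fun y hy i a hia => ?_⟩
    rw [hy i (List.getElem?_eq_some_iff.1 hia).1, hx i a hia]
  have hne : (extensions p.seq).Nonempty :=
    ⟨fun i => p.seq[i]?.getD 0, fun i a h => by simp [h]⟩
  obtain ⟨x, hxp, hxU⟩ := hd.inter_open_nonempty _ hopen hne
  obtain ⟨n, hn⟩ := exists_cylinder_subset hU hxU
  refine ⟨⟨p.seq ++ (List.range n).map fun i => x (p.seq.length + i)⟩, fun y hy => hn y ?_,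
    List.prefix_append _ _⟩
  intro i hi
  refine hy i (x i) ?_
  rcases lt_or_ge i p.seq.length with h | h
  · rw [List.getElem?_append_left h, List.getElem?_eq_getElem h,
      hxp i _ (List.getElem?_eq_getElem h)]
  · rw [List.getElem?_append_right h]
    simp only [List.getElem?_map, Option.map_eq_some_iff]
    exact ⟨i - p.seq.length, List.getElem?_range (by omega), by rw [Nat.add_sub_cancel' h]⟩

theorem exists_seq_isOpen_dense {A : Set (ℕ → ℕ)} (hA : IsMeagre A) :
    ∃ U : ℕ → Set (ℕ → ℕ), (∀ n, IsOpen (U n)) ∧ (∀ n, Dense (U n)) ∧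
      ∀ x, (∀ n, x ∈ U n) → x ∉ A := by
  obtain ⟨S, hSo, hSd, hSc, hS⟩ := mem_residual_iff.1 hA
  -- Adding the whole space makes the family nonempty, hence enumerable by ℕ.
  obtain ⟨U, hU⟩ := (hSc.insert Set.univ).exists_eq_range (Set.insert_nonempty _ _)
  have hmem : ∀ n, U n ∈ insert Set.univ S := fun n => hU ▸ ⟨n, rfl⟩
  refine ⟨U, fun n => ?_, fun n => ?_, fun x hx => hS ?_⟩
  · rcases hmem n with h | h
    · exact h ▸ isOpen_univ
    · exact hSo _ h
  · rcases hmem n with h | h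
    · exact h ▸ dense_univ
    · exact hSd _ h
  · intro t ht
    obtain ⟨n, rfl⟩ : t ∈ Set.range U := hU ▸ Set.mem_insert_of_mem _ ht
    exact hx n

theorem exists_unmetDense_of_meagerCover {κ : Cardinal} (hκ : κ ∈ meagerCoverSizes) :
    ∃ μ ∈ unmetDenseSizes CohenForcing, μ ≤ κ := by
  obtain ⟨F, hF, hcov, rfl⟩ := hκ
  choose U hUo hUd hU using fun A : F => exists_seq_isOpen_dense (hF A.1 A.2)
  refine ⟨_, ⟨Set.range fun q : F × ℕ => {p | extensions p.seq ⊆ U q.1 q.2}, ?_, ?_, rfl⟩, ?_⟩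
  · rintro _ ⟨q, rfl⟩
    exact isDenseSet_extensions_subset (hUo _ _) (hUd _ _)
  · rintro ⟨G, hG⟩
    obtain ⟨f, hf⟩ := exists_forall_mem_extensions G
    obtain ⟨A, hA, hfA⟩ : f ∈ ⋃₀ F := hcov ▸ trivial
    refine hU ⟨A, hA⟩ f (fun n => ?_) hfA
    obtain ⟨p, hp, hpG⟩ := hG _ ⟨(⟨A, hA⟩, n), rfl⟩
    exact hp (hf p hpG)
  · refine Cardinal.mk_range_le.trans ?_
    rw [Cardinal.mk_prod, Cardinal.mk_nat, Cardinal.lift_id, Cardinal.lift_aleph0,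
      Cardinal.mul_aleph0_eq (aleph0_lt_mk_of_sUnion_eq_univ hF hcov).le]

/-! ### Infinitely often equal functions and Cohen generic filters -/

/-- Any family of functions on `ℕ` that is indexed by `ι` has a common infinitely often equal
function. -/
def InfinitelyOftenEqual (ι : Type) : Prop :=
  ∀ f : ι → ℕ → ℕ, ∃ g : ℕ → ℕ, ∀ i, {n | g n = f i n}.Infinite

variable {ι : Type}

theorem InfinitelyOftenEqual.exists_of_countable (h : InfinitelyOftenEqual ι) {α : Type}
    [Countable α] [Nonempty α] (f : ι → ℕ → α) :
    ∃ g : ℕ → α, ∀ i, {n | g n = f i n}.Infinite := by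
  obtain ⟨e, he⟩ := Countable.exists_injective_nat α
  obtain ⟨g, hg⟩ := h fun i n => e (f i n)
  refine ⟨fun n => Function.invFun e (g n), fun i => (hg i).mono fun n hn => ?_⟩
  change Function.invFun e (g n) = f i n
  rw [show g n = e (f i n) from hn, Function.leftInverse_invFun he]

/-- The sequence `n` iterates a monotone bound of a function `r` that equals `B i (B i m) + 1`
infinitely often. If `n (k + 1) < B i (n k)` held from some point on, two consecutive steps would
force `r m < B i (B i m)` for all large `m`. -/
theorem InfinitelyOftenEqual.exists_strictMono (h : InfinitelyOftenEqual ι) (b : ι → ℕ → ℕ) :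
    ∃ n : ℕ → ℕ, StrictMono n ∧ ∀ i, {k | b i (n k) ≤ n (k + 1)}.Infinite := by
  let B : ι → ℕ → ℕ := fun i m => ∑ l ∈ Finset.range (m + 1), b i l
  have hB : ∀ i, Monotone (B i) := fun i m m' hm =>
    Finset.sum_le_sum_of_subset (Finset.range_mono (by omega))
  have hbB : ∀ i m, b i m ≤ B i m := fun i m =>
    Finset.single_le_sum (f := b i) (fun _ _ => Nat.zero_le _) (Finset.self_mem_range_succ m)
  obtain ⟨r, hr⟩ := h fun i m => B i (B i m) + 1
  let R : ℕ → ℕ := strictBound r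
  have hR : Monotone R := (strictBound_strictMono r).monotone
  have hRr : ∀ m, r m < R m := fun m => lt_strictBound r le_rfl
  have hRid : ∀ m, m < R m := fun m => by
    induction m with
    | zero => exact (Nat.zero_le _).trans_lt (hRr 0)
    | succ m ih => exact Nat.lt_of_le_of_lt ih (strictBound_strictMono r m.lt_succ_self)
  let n : ℕ → ℕ := fun k => R^[k] 0
  have hn1 : ∀ k, n (k + 1) = R (n k) := fun k => Function.iterate_succ_apply' R k 0
  have hn : StrictMono n := strictMono_nat_of_lt_succ fun k => hn1 k ▸ hRid _
  refine ⟨n, hn, fun i => ?_⟩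
  rw [← Nat.frequently_atTop_iff_infinite, Filter.frequently_atTop]
  by_contra! hcon
  obtain ⟨K, hK⟩ := hcon
  have hlt : ∀ k ≥ K, n (k + 1) < B i (n k) := fun k hk => (hK k hk).trans_le (hbB i _)
  obtain ⟨m, hm, hmK⟩ := (hr i).exists_gt (n K)
  obtain ⟨k, hk, hkm, hmk⟩ : ∃ k ≥ K, n k ≤ m ∧ m < n (k + 1) := by
    have hex : ∃ j, m < n (K + j + 1) := ⟨m, by have := hn.id_le (K + m + 1); simp at this; omega⟩
    refine ⟨K + Nat.find hex, by omega, ?_, Nat.find_spec hex⟩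
    rcases hj : Nat.find hex with _ | j
    · exact hmK.le
    · exact not_lt.1 (Nat.find_min hex (m := j) (by omega))
  have h1 : r m < n (k + 2) := (hRr m).trans_le ((hR hmk.le).trans_eq (hn1 (k + 1)).symm)
  have h2 : n (k + 2) < B i (n (k + 1)) := hlt (k + 1) (by omega)
  have h3 : B i (n (k + 1)) ≤ B i (B i (n k)) := hB i (hlt k hk).le
  have h4 : B i (B i (n k)) ≤ B i (B i m) := hB i (hB i hkm)
  have h5 : r m = B i (B i m) + 1 := hm
  omega

/-- Hall's condition holds because the set with the largest index is already big enough. -/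
theorem exists_injective_forall_mem (K : ℕ → Finset ℕ) (hK : ∀ n, (K n).card = n + 1) :
    ∃ k : ℕ → ℕ, Function.Injective k ∧ ∀ n, k n ∈ K n := by
  refine (Finset.all_card_le_biUnion_card_iff_exists_injective K).1 fun s => ?_
  rcases s.eq_empty_or_nonempty with rfl | hs
  · simp
  · calc s.card ≤ (Finset.range (s.max' hs + 1)).card :=
          Finset.card_le_card fun i hi =>
            Finset.mem_range.2 (Nat.lt_succ_of_le (s.le_max' i hi))
      _ = (K (s.max' hs)).card := by rw [Finset.card_range, hK]
      _ ≤ _ := Finset.card_le_card (Finset.subset_biUnion_of_mem K (s.max'_mem hs))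

/-- The `n`-th guess names `n + 1` points of `X i` together with a table of `f i` covering them.
Distinct representatives `k n` let each guess decide one value of `g` without conflict; a correct
guess gives agreement at a point of `X i`. -/
theorem InfinitelyOftenEqual.exists_eq_on (h : InfinitelyOftenEqual ι) {α : Type}
    [Countable α] [Inhabited α] (f : ι → ℕ → α) (X : ι → Set ℕ) (hX : ∀ i, (X i).Infinite) :
    ∃ g : ℕ → α, ∀ i, ∃ n ∈ X i, g n = f i n := by
  choose K hKX hK using fun i n => (hX i).exists_subset_card_eq (n + 1)
  obtain ⟨g, hg⟩ := h.exists_of_countable fun i n =>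
    (K i n, (List.range ((K i n).sup id + 1)).map (f i))
  obtain ⟨k, hk, hkK⟩ := exists_injective_forall_mem
    -- Guesses of the wrong size are replaced so that Hall's theorem applies to all `n`.
    (fun n => if (g n).1.card = n + 1 then (g n).1 else Finset.range (n + 1)) fun n => by
      split_ifs with hc
      · exact hc
      · exact Finset.card_range _
  refine ⟨fun m => ((g (Function.invFun k m)).2[m]?).getD default, fun i => ?_⟩
  obtain ⟨n, hn⟩ := (hg i).nonempty
  have hn : g n = _ := hn
  have hkn : k n ∈ K i n := by simpa [hn, hK] using hkK n
  refine ⟨k n, hKX i n hkn, ?_⟩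
  have hle : k n < (K i n).sup id + 1 := Nat.lt_succ_of_le (Finset.le_sup (f := id) hkn)
  simp only [Function.leftInverse_invFun hk n, hn, List.getElem?_map, List.getElem?_range hle,
    Option.map_some, Option.getD_some]

/-- Only finitely many conditions have small code, so one string can serve them in turn. -/
theorem exists_forall_append_meets {D : Set CohenForcing} (hD : IsDenseSet D) (n : ℕ) :
    ∃ s : List ℕ, ∀ p : List ℕ, Encodable.encode p < n → ∃ q ∈ D, q.seq <+: p ++ s := by
  induction n with
  | zero => exact ⟨[], fun p hp => absurd hp (Nat.not_lt_zero _)⟩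
  | succ n ih =>
    obtain ⟨s, hs⟩ := ih
    have key : ∃ t : List ℕ, ∀ p : List ℕ, Encodable.encode p = n →
        ∃ q ∈ D, q.seq <+: p ++ s ++ t := by
      by_cases hp : ∃ p : List ℕ, Encodable.encode p = n
      · obtain ⟨p, hp⟩ := hp
        obtain ⟨q, hq, t, ht⟩ := hD ⟨p ++ s⟩
        refine ⟨t, fun p' hp' => ⟨q, hq, ?_⟩⟩
        rw [Encodable.encode_injective (hp'.trans hp.symm)]
        exact ht ▸ List.prefix_rfl
      · exact ⟨[], fun p h => (hp ⟨p, h⟩).elim⟩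
    obtain ⟨t, ht⟩ := key
    refine ⟨s ++ t, fun p hp => ?_⟩
    rw [← List.append_assoc]
    rcases (Nat.lt_succ_iff_lt_or_eq.1 hp) with h | h
    · obtain ⟨q, hq, hqp⟩ := hs p h
      exact ⟨q, hq, hqp.trans (List.prefix_append _ _)⟩
    · exact ht p h

theorem exists_encode_append_le (s : List ℕ) (n : ℕ) :
    ∃ b, ∀ p : List ℕ, Encodable.encode p < n → Encodable.encode (p ++ s) ≤ b := by
  have hfin : {p : List ℕ | Encodable.encode p < n}.Finite :=
    (Set.finite_lt_nat n).preimage Encodable.encode_injective.injOn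
  obtain ⟨b, hb⟩ := (hfin.image fun p => Encodable.encode (p ++ s)).bddAbove
  exact ⟨b, fun p hp => hb ⟨p, hp, rfl⟩⟩

theorem exists_pfilter_of_chain (p : ℕ → List ℕ) (hp : ∀ k, p k <+: p (k + 1)) :
    ∃ G : Order.PFilter CohenForcing, ∀ q : CohenForcing, q ∈ G ↔ ∃ k, q.seq <+: p k := by
  have hmono : ∀ k l, k ≤ l → p k <+: p l := fun k l hkl =>
    Nat.le_induction List.prefix_rfl (fun l _ ih => ih.trans (hp l)) l hkl
  have hG : Order.IsPFilter {q : CohenForcing | ∃ k, q.seq <+: p k} := by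
    refine Order.IsPFilter.of_def ⟨⟨p 0⟩, 0, List.prefix_rfl⟩ ?_ ?_
    · rintro q ⟨k, hk⟩ q' ⟨l, hl⟩
      exact ⟨⟨p (max k l)⟩, ⟨_, List.prefix_rfl⟩, hk.trans (hmono _ _ (le_max_left _ _)),
        hl.trans (hmono _ _ (le_max_right _ _))⟩
    · rintro q q' hqq' ⟨k, hk⟩
      exact ⟨k, List.IsPrefix.trans hqq' hk⟩
  exact ⟨hG.toPFilter, fun q => Iff.rfl⟩

/-- A chain of conditions appends the guess `g k` whenever the code stays at most `n (k + 1)`. At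
some `k` where the bound for `D i` fits below `n (k + 1)`, the guess is the string that enters `D i`
from every condition of code at most `n k`, in particular from `p k`. -/
theorem InfinitelyOftenEqual.exists_pfilter (h : InfinitelyOftenEqual ι)
    (D : ι → Set CohenForcing) (hD : ∀ i, IsDenseSet (D i)) :
    ∃ G : Order.PFilter CohenForcing, ∀ i, ∃ p ∈ D i, p ∈ G := by
  choose s hs using fun i n => exists_forall_append_meets (hD i) (n + 1)
  choose b hb using fun i n => exists_encode_append_le (s i n) (n + 1)
  obtain ⟨n, hn, hX⟩ := h.exists_strictMono b
  obtain ⟨g, hg⟩ := h.exists_eq_on (fun i k => s i (n k)) _ hX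
  let step : ℕ → List ℕ → List ℕ := fun k l =>
    if Encodable.encode (l ++ g k) ≤ n (k + 1) then l ++ g k else l
  let p : ℕ → List ℕ := fun k => Nat.rec [] step k
  have hp : ∀ k, p (k + 1) = step k (p k) := fun k => rfl
  have hpn : ∀ k, Encodable.encode (p k) ≤ n k := fun k => by
    induction k with
    | zero => simp [p]
    | succ k ih =>
      rw [hp]
      dsimp only [step]
      split_ifs with hc
      · exact hc
      · exact ih.trans (hn k.lt_succ_self).le
  obtain ⟨G, hG⟩ := exists_pfilter_of_chain p fun k => by
    rw [hp]
    dsimp only [step]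
    split_ifs
    · exact List.prefix_append _ _
    · exact List.prefix_rfl
  refine ⟨G, fun i => ?_⟩
  obtain ⟨k, hk, hgk⟩ := hg i
  have hlt : Encodable.encode (p k) < n k + 1 := Nat.lt_succ_of_le (hpn k)
  obtain ⟨q, hq, hqp⟩ := hs i (n k) (p k) hlt
  refine ⟨q, hq, (hG q).2 ⟨k + 1, ?_⟩⟩
  rw [hp]
  dsimp only [step]
  rwa [hgk, if_pos ((hb i (n k) (p k) hlt).trans hk)]

theorem exists_eventuallyDifferent_of_unmetDense {κ : Cardinal}
    (hκ : κ ∈ unmetDenseSizes CohenForcing) : ∃ μ ∈ eventuallyDifferentSizes, μ ≤ κ := by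
  obtain ⟨𝒟, h𝒟, hG, rfl⟩ := hκ
  by_contra! hcon
  have hE : InfinitelyOftenEqual 𝒟 := by
    intro f
    -- Pairing each value with its argument makes an arbitrary function injective.
    let F : 𝒟 → (ℕ ↪ ℕ) := fun i =>
      ⟨fun n => Nat.pair n (f i n), fun m n hmn => (Nat.pair_eq_pair.1 hmn).1⟩
    have hF : ¬ ∀ w : ℕ ↪ ℕ, ∃ s ∈ Set.range F, {n | s n = w n}.Finite := fun hS =>
      (hcon _ ⟨Set.range F, hS, rfl⟩).not_ge Cardinal.mk_range_le
    push Not at hF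
    obtain ⟨w, hw⟩ := hF
    refine ⟨fun n => (Nat.unpair (w n)).2, fun i => (hw _ ⟨i, rfl⟩).mono fun n hn => ?_⟩
    have hn : Nat.pair n (f i n) = w n := hn
    simp [← hn]
  obtain ⟨G, hGD⟩ := hE.exists_pfilter (fun D => D.1) fun D => h𝒟 _ D.2
  exact hG ⟨G, fun D hD => hGD ⟨D, hD⟩⟩

/-! ### Winning sets from eventually different families -/

variable {C : Type}

/-- The permutation of the colors that moves `d` to `c`, `c` to `b` and `b` to `d` (if these are
distinct). -/
noncomputable def threeCycle (b c d : C) : Equiv.Perm C :=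
  open Classical in Equiv.swap d c * Equiv.swap c b

theorem threeCycle_self (c : C) : threeCycle c c c = 1 := by
  simp only [threeCycle, Equiv.swap_self]
  rfl

/-- Recoloring makes peg `n` correct for `w` but not for `w'`. A plain swap could create a match
with `w'` where `s` used the color `w n`; the third color, taken from a remote peg `j`, prevents
this. So the count rises by one for `w` and does not rise for `w'`, which finiteness makes visible.
-/
theorem correctCount_threeCycle_comp_ne {s w w' : ℕ ↪ C} (hw : {n | s n = w n}.Finite)
    (hw' : {n | s n = w' n}.Finite) {n : ℕ} (hn : w n ≠ w' n) (hsn : s n ≠ w n)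
    (heq : correctCount s w = correctCount s w') :
    ∃ b, correctCount (s.trans (threeCycle b (w n) (s n)).toEmbedding) w ≠
      correctCount (s.trans (threeCycle b (w n) (s n)).toEmbedding) w' := by
  classical
  have hinj : ∀ (u v : ℕ ↪ C) (m : ℕ), ∀ᶠ j in Filter.atTop, u j ≠ v m := fun u v m => by
    rw [← Nat.cofinite_eq_atTop]
    exact u.injective.tendsto_cofinite.eventually
      ((Set.finite_singleton (v m)).compl_mem_cofinite)
  have hfin : ∀ {v : ℕ ↪ C}, {n | s n = v n}.Finite → ∀ᶠ j in Filter.atTop, s j ≠ v j :=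
    fun h => by
      rw [← Nat.cofinite_eq_atTop]
      exact h.compl_mem_cofinite
  have hpre : ∀ᶠ j in Filter.atTop, ∀ m, s m = w n → s j ≠ w m ∧ s j ≠ w' m := by
    by_cases hm : ∃ m, s m = w n
    · obtain ⟨m, hm⟩ := hm
      filter_upwards [hinj s w m, hinj s w' m] with j h1 h2 m' hm'
      rw [s.injective (hm'.trans hm.symm)]
      exact ⟨h1, h2⟩
    · exact Filter.Eventually.of_forall fun j m h => (hm ⟨m, h⟩).elim
  obtain ⟨j, hj1, hj2, hj3, hj4, hj5, hj6, hj7⟩ := (hpre.and <| (hinj w s n).and <|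
    (hinj w' s n).and <| (hfin hw).and <| (hfin hw').and <| (hinj s w n).and
      (hinj s s n)).exists
  refine ⟨s j, ?_⟩
  set t := s.trans (threeCycle (s j) (w n) (s n)).toEmbedding with ht
  have htm : ∀ m, t m = if m = n then w n else if m = j then s n else if s m = w n then s j
      else s m := by
    intro m
    change threeCycle (s j) (w n) (s n) (s m) = _
    unfold threeCycle
    rw [Equiv.Perm.mul_apply]
    split_ifs with h1 h2 h3
    · subst h1
      rw [Equiv.swap_apply_of_ne_of_ne hsn hj7.symm, Equiv.swap_apply_left]
    · subst h2
      rw [Equiv.swap_apply_right, Equiv.swap_apply_right]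
    · rw [h3, Equiv.swap_apply_left, Equiv.swap_apply_of_ne_of_ne hj7 hj6]
    · have h2' : s m ≠ s j := fun h => h2 (s.injective h)
      have h1' : s m ≠ s n := fun h => h1 (s.injective h)
      rw [Equiv.swap_apply_of_ne_of_ne h3 h2', Equiv.swap_apply_of_ne_of_ne h1' h3]
  have hcard : correctCount t w = correctCount s w + 1 := by
    have : {m | t m = w m} = insert n {m | s m = w m} := by
      ext m
      simp only [Set.mem_ofPred_eq, Set.mem_insert_iff, htm]
      split_ifs with h1 h2 h3
      · simp [h1]
      · subst h2
        simp [h1, hj4, hj2.symm]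
      · have : s m ≠ w m := fun h => h1 (w.injective (h.symm.trans h3))
        simp [h1, this, (hj1 m h3).1]
      · simp [h1]
    rw [correctCount, correctCount, this, Set.encard_insert_of_notMem]
    exact hsn
  have hle : correctCount t w' ≤ correctCount s w' := by
    refine Set.encard_le_encard fun m hm => ?_
    have hm : t m = w' m := hm
    rw [htm] at hm
    split_ifs at hm with h1 h2 h3
    · exact (hn (h1 ▸ hm)).elim
    · exact (hj3 (h2 ▸ hm.symm)).elim
    · exact ((hj1 m h3).2 hm).elim
    · exact hm
  have hlt : correctCount s w' < correctCount s w' + 1 :=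
    ENat.lt_add_one_iff (Set.encard_ne_top_iff.2 hw') |>.2 le_rfl
  rw [hcard, heq]
  exact (hle.trans_lt hlt).ne'

/-- The members of `S` with the colors permuted by the permutations `threeCycle b c d`. -/
def recolorings (S : Set (ℕ ↪ C)) : Set (ℕ ↪ C) :=
  Set.range fun p : S × C × C × C => p.1.1.trans (threeCycle p.2.1 p.2.2.1 p.2.2.2).toEmbedding

theorem isWinningSet_recolorings {S : Set (ℕ ↪ C)}
    (hS : ∀ w : ℕ ↪ C, ∃ s ∈ S, {n | s n = w n}.Finite) :
    IsWinningSet correctCount (recolorings S) := by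
  intro w w' h
  by_contra hne
  obtain ⟨s, hs, hw⟩ := hS w
  have hsub : ∀ b c d, correctCount (s.trans (threeCycle b c d).toEmbedding) w =
      correctCount (s.trans (threeCycle b c d).toEmbedding) w' := fun b c d =>
    h _ ⟨(⟨s, hs⟩, b, c, d), rfl⟩
  -- The degenerate cycle is the identity, so `s` is itself among the recolorings.
  have heq : correctCount s w = correctCount s w' := by
    have := hsub (s 0) (s 0) (s 0)
    rw [threeCycle_self] at this
    exact this
  have hw' : {n | s n = w' n}.Finite := by
    rw [← Set.encard_ne_top_iff] at hw ⊢
    exact fun h => hw (heq.trans h)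
  obtain ⟨n, hn⟩ : ∃ n, w n ≠ w' n := by
    by_contra! hall
    exact hne (DFunLike.ext _ _ hall)
  by_cases hsn : s n = w n
  · obtain ⟨b, hb⟩ :=
      correctCount_threeCycle_comp_ne hw' hw hn.symm (fun h => hn (hsn.symm.trans h)) heq.symm
    exact hb (hsub _ _ _).symm
  · obtain ⟨b, hb⟩ := correctCount_threeCycle_comp_ne hw hw' hn hsn heq
    exact hb (hsub _ _ _)

theorem exists_winningSet_of_eventuallyDifferent [Countable C] [Infinite C] {κ : Cardinal}
    (hκ : κ ∈ eventuallyDifferentSizes) :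
    ∃ μ ∈ winningSizes (correctCount (C := C)), μ ≤ κ := by
  obtain ⟨μ, hμ, hμκ⟩ := exists_meagerCover_of_eventuallyDifferent hκ
  -- Being infinite, κ absorbs the countable factor of recolorings.
  have hκ0 : ℵ₀ ≤ κ := aleph0_lt_covMeager.le.trans ((csInf_le' hμ).trans hμκ)
  obtain ⟨S, hS, rfl⟩ := hκ
  obtain ⟨e⟩ := nonempty_equiv_of_countable (α := C) (β := ℕ)
  let T : Set (ℕ ↪ C) := (fun s : ℕ ↪ ℕ => s.trans e.symm.toEmbedding) '' S
  have hT : ∀ w : ℕ ↪ C, ∃ s ∈ T, {n | s n = w n}.Finite := fun w => by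
    obtain ⟨s, hs, hfin⟩ := hS (w.trans e.toEmbedding)
    refine ⟨_, ⟨s, hs, rfl⟩, hfin.subset fun n hn => ?_⟩
    exact e.symm_apply_eq.1 hn
  refine ⟨_, ⟨recolorings T, isWinningSet_recolorings hT, rfl⟩, ?_⟩
  calc #(recolorings T) ≤ #(T × C × C × C) := Cardinal.mk_range_le
    _ = #T * ℵ₀ := by simp
    _ ≤ #S * ℵ₀ := mul_le_mul_left Cardinal.mk_image_le _
    _ = #S := Cardinal.mul_aleph0_eq hκ0

/-! ### Saturated words -/

/-- The word `w` is saturated for the guessword `s` if it agrees with `s` infinitely often, has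
infinitely often the color of `s` at the next, odd position, and omits infinitely many colors of
`s`. -/
def Saturated (s w : ℕ → C) : Prop :=
  {n | w n = s n}.Infinite ∧ {n | w (2 * n) = s (2 * n + 1)}.Infinite ∧
    {n | s n ∉ Set.range w}.Infinite

/-- This supplies the second codeword that the feedback cannot distinguish from `w`. -/
theorem Saturated.comp_swap {s w : ℕ → C} (h : Saturated s w) :
    Saturated s (w ∘ Equiv.swap 0 1) := by
  obtain ⟨h1, h2, h3⟩ := h
  have hfix : ∀ n, 1 < n → (w ∘ Equiv.swap 0 1) n = w n := fun n hn => by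
    rw [Function.comp_apply, Equiv.swap_apply_of_ne_of_ne (by omega) (by omega)]
  refine ⟨(h1.sdiff (Set.finite_Iic 1)).mono ?_, (h2.sdiff (Set.finite_Iic 1)).mono ?_, ?_⟩
  · rintro n ⟨hn, h⟩
    exact (hfix n (not_le.1 h)).trans hn
  · rintro n ⟨hn, h⟩
    exact (hfix (2 * n) (by simp at h; omega)).trans hn
  · rwa [(Equiv.swap 0 1).surjective.range_comp]

theorem Saturated.correctCount_eq {s w : ℕ → C} (h : Saturated s w) : correctCount s w = ⊤ :=
  Set.encard_eq_top (h.1.mono fun _ hn => Eq.symm hn)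

theorem Saturated.incorrectCount_eq {s w : ℕ → C} (h : Saturated s w) : incorrectCount s w = ⊤ :=
  Set.encard_eq_top (h.2.2.mono fun n (hn : s n ∉ Set.range w) h => hn ⟨n, h.symm⟩)

theorem Saturated.inherentErrorCount_eq {s w : ℕ → C} (h : Saturated s w) :
    inherentErrorCount s w = ⊤ := by
  refine iInf_eq_top.2 fun π => Set.encard_eq_top fun hfin => h.2.2 ?_
  refine ((hfin.image fun n => (π n).1)).subset fun m hm => ?_
  -- A peg whose color `w` omits is incorrect wherever it is moved.
  have hmI : s m ≠ w m := fun h => hm ⟨m, h.symm⟩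
  exact ⟨π.symm ⟨m, hmI⟩, fun hc => hm ⟨_, (by simpa using hc : s m = _).symm⟩, by simp⟩

theorem Saturated.rearrangementCount_eq {s w : ℕ → C} (h : Saturated s w) (hs : s.Injective)
    (hw : w.Injective) : rearrangementCount s w = ⊤ := by
  classical
  -- Positions `2k` and `2k + 1` are exchanged when this corrects `2k`; injectivity of `s` and `w`
  -- makes both incorrect beforehand, so `σ` restricts to the incorrect pegs.
  let σ : ℕ → ℕ := fun n =>
    if n % 2 = 0 then if w n = s (n + 1) then n + 1 else n
    else if w (n - 1) = s n then n - 1 else n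
  have hσ : Function.Involutive σ := fun n => by
    dsimp only [σ]
    rcases Nat.mod_two_eq_zero_or_one n with h0 | h0
    · by_cases h1 : w n = s (n + 1)
      · simp [h0, h1, show (n + 1) % 2 = 1 by omega]
      · simp [h0, h1]
    · obtain ⟨m, rfl⟩ : ∃ m, n = m + 1 := ⟨n - 1, by omega⟩
      have hm : m % 2 = 0 := by omega
      by_cases h1 : w m = s (m + 1)
      · simp [h0, h1, hm]
      · simp [h0, h1]
  have hI : ∀ n, s n ≠ w n → s (σ n) ≠ w (σ n) := fun n hn => by
    dsimp only [σ]
    split_ifs with h0 h1 h1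
    · rw [← h1]
      exact hw.ne n.lt_succ_self.ne
    · exact hn
    · rw [h1]
      exact hs.ne (by omega)
    · exact hn
  let π : Equiv.Perm {n : ℕ // s n ≠ w n} :=
    Function.Involutive.toPerm (fun n => ⟨σ n.1, hI n.1 n.2⟩) fun n => Subtype.ext (hσ n.1)
  refine top_le_iff.1 (le_iSup_of_le π (top_le_iff.2 (Set.encard_eq_top fun hfin => h.2.1 ?_)))
  refine ((hfin.image Subtype.val).preimage
    (mul_right_injective₀ (two_ne_zero (α := ℕ))).injOn).subset fun n hn => ?_
  have hn : w (2 * n) = s (2 * n + 1) := hn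
  refine ⟨⟨2 * n, fun h => hs.ne (2 * n).lt_succ_self.ne (h.trans hn)⟩, ?_, rfl⟩
  change s (σ (2 * n)) = w (2 * n)
  simp [σ, hn]

/-- A feedback that gives the same answer for all saturated codewords has only winning sets of size
at least the covering number. -/
theorem exists_meagerCover_of_winningSet [Countable C] [Infinite C] {F : Type}
    {feedback : (ℕ → C) → (ℕ → C) → F}
    (hfb : ∀ s w w' : ℕ ↪ C, Saturated s w → Saturated s w' → feedback s w = feedback s w')
    {κ : Cardinal} (hκ : κ ∈ winningSizes feedback) : ∃ μ ∈ meagerCoverSizes, μ ≤ κ := by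
  obtain ⟨S, hS, rfl⟩ := hκ
  obtain ⟨e⟩ := nonempty_equiv_of_countable (α := C) (β := ℕ)
  -- Only even places of the generic injection are used; colors at odd places are those the codeword
  -- omits.
  let word : (ℕ → ℕ) → (ℕ ↪ C) := fun x =>
    ⟨fun n => e.symm (makeInjective x (2 * n)), fun m n h => by
      simpa using makeInjective_injective x (e.symm.injective h)⟩
  refine exists_meagerCover_of_residual (fun (s : S) x => Saturated s.1 (word x)) ?_ ?_
  · rintro ⟨s, -⟩
    have hs : Function.Injective fun n => e (s n) := e.injective.comp s.injective
    have hs' : Function.Injective fun n => e (s (2 * n + 1)) := fun m n h => by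
      simpa using hs h
    filter_upwards [residual_infinite_makeInjective_eq (φ := fun n => 2 * n) hs
        (fun m n h => by simpa using h),
      residual_infinite_makeInjective_eq (φ := fun n => 2 * (2 * n)) hs'
        (fun m n h => by simpa using h),
      residual_infinite_makeInjective_eq (φ := fun n => 2 * n + 1) hs
        (fun m n h => by simpa using h)] with x h1 h2 h3
    refine ⟨h1.mono fun n hn => e.symm_apply_eq.2 hn, h2.mono fun n hn => e.symm_apply_eq.2 hn,
      h3.mono ?_⟩
    rintro n hn ⟨m, hm⟩
    have := makeInjective_injective x ((e.symm_apply_eq.1 hm).trans (Eq.symm hn))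
    omega
  · intro x
    by_contra! hsat
    have h := hS (word x) ((Equiv.swap 0 1).toEmbedding.trans (word x)) fun s hs =>
      hfb _ _ _ (hsat ⟨s, hs⟩) (hsat ⟨s, hs⟩).comp_swap
    have h0 := DFunLike.congr_fun h 0
    exact zero_ne_one ((word x).injective h0)

theorem winningSizes_mono {F F' : Type} {fb : (ℕ → C) → (ℕ → C) → F}
    {fb' : (ℕ → C) → (ℕ → C) → F'} (h : ∀ s w w', fb' s w = fb' s w' → fb s w = fb s w') :
    ∀ κ ∈ winningSizes fb, ∃ μ ∈ winningSizes fb', μ ≤ κ := by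
  rintro _ ⟨S, hS, rfl⟩
  exact ⟨_, ⟨S, fun w w' hw => hS w w' fun s hs => h _ _ _ (hw s hs), rfl⟩, le_rfl⟩

end InfiniteMastermind

/-! ### The cycle of inequalities -/

theorem mainTheorem1 (C : Type) [Countable C] [Infinite C] :
    InfiniteMastermind.mm C = InfiniteMastermind.mms C ∧
    InfiniteMastermind.mms C = InfiniteMastermind.mmEq C ∧
    InfiniteMastermind.mmEq C = InfiniteMastermind.eventuallyDifferentInj ∧
    InfiniteMastermind.eventuallyDifferentInj = InfiniteMastermind.covMeager ∧
    InfiniteMastermind.covMeager =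
      InfiniteMastermind.martinNumber InfiniteMastermind.CohenForcing := by
  open InfiniteMastermind in
  obtain ⟨hcov, h1⟩ := sInf_le_sInf_of_forall_exists eventuallyDifferentSizes_nonempty
    fun _ => exists_meagerCover_of_eventuallyDifferent
  obtain ⟨hm, h2⟩ := sInf_le_sInf_of_forall_exists hcov fun _ => exists_unmetDense_of_meagerCover
  obtain ⟨-, h3⟩ := sInf_le_sInf_of_forall_exists hm
    fun _ => exists_eventuallyDifferent_of_unmetDense
  obtain ⟨heq, h4⟩ := sInf_le_sInf_of_forall_exists eventuallyDifferentSizes_nonempty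
    fun _ => exists_winningSet_of_eventuallyDifferent (C := C)
  obtain ⟨hmm, h5⟩ := sInf_le_sInf_of_forall_exists heq <|
    winningSizes_mono (fb' := mastermindFeedback) fun _ _ _ h => congrArg Prod.fst h
  obtain ⟨hmms, h6⟩ := sInf_le_sInf_of_forall_exists heq <|
    winningSizes_mono (fb' := simplifiedFeedback) fun _ _ _ h => congrArg Prod.fst h
  obtain ⟨-, h7⟩ := sInf_le_sInf_of_forall_exists hmm fun _ =>
    exists_meagerCover_of_winningSet fun s w w' h h' => by
      rw [mastermindFeedback, mastermindFeedback, h.correctCount_eq, h'.correctCount_eq,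
        h.rearrangementCount_eq s.injective w.injective,
        h'.rearrangementCount_eq s.injective w'.injective, h.inherentErrorCount_eq,
        h'.inherentErrorCount_eq]
  obtain ⟨-, h8⟩ := sInf_le_sInf_of_forall_exists hmms fun _ =>
    exists_meagerCover_of_winningSet fun s w w' h h' => by
      rw [simplifiedFeedback, simplifiedFeedback, h.correctCount_eq, h'.correctCount_eq,
        h.incorrectCount_eq, h'.incorrectCount_eq]
  change covMeager ≤ eventuallyDifferentInj at h1
  change martinNumber CohenForcing ≤ covMeager at h2
  change eventuallyDifferentInj ≤ martinNumber CohenForcing at h3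
  change mmEq C ≤ eventuallyDifferentInj at h4
  change mm C ≤ mmEq C at h5
  change mms C ≤ mmEq C at h6
  change covMeager ≤ mm C at h7
  change covMeager ≤ mms C at h8
  have hd : eventuallyDifferentInj = covMeager := (h3.trans h2).antisymm h1
  have e1 : mm C = covMeager := ((h5.trans h4).trans hd.le).antisymm h7
  have e2 : mms C = covMeager := ((h6.trans h4).trans hd.le).antisymm h8
  have e3 : mmEq C = covMeager := (h4.trans hd.le).antisymm (h7.trans h5)
  exact ⟨e1.trans e2.symm, e2.trans e3.symm, e3.trans hd.symm, hd,
    (h1.trans h3).antisymm h2⟩
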